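/- Write $L^2=L^2(\mathbb R^3;\mathbb R)$, $\mathbf L^2=L^2(\mathbb R^3;\mathbb R^3)$, and let $\mathcal L^2$ be the Hilbert space of square integrable fields of real symmetric $3\times 3$ matrices on $\mathbb R^3$, with the Frobenius inner product on matrices. Let $\hat f(\xi)=\int f(x)e^{-2\pi i x\cdot\xi}\,dx$ be the (unitary) Fourier transform, and let $\partial_j(-\Delta)^{-1/2}$ be the Fourier multiplier with symbol $i\xi_j/|\xi|$. Let $\mathbf L^2_{df}=\{u\in\mathbf L^2:\nabla\cdot(-\Delta)^{-1/2}u=0\}$, let the strain space be $$\mathcal L^2_{st}=\{\nabla_{sym}(-\Delta)^{-1/2}u:u\in\mathbf L^2_{df}\},\qquad (\nabla_{sym}w)_{ij}=\tfrac12(\partial_i w_j+\partial_j w_i),$$ which is a closed subspace of $\mathcal L^2$, and let $P_{st}$ be the orthogonal projection of $\mathcal L^2$ onto $\mathcal L^2_{st}$. For a matrix field $S$ and a vector $v$ write $S:(v\otimes v)=\sum_{i,j}v_iv_jS_{ij}$. **Theorem.** Let $v\in\mathbb R^3$ be a fixed vector with $|v|=1$. 1. There is no $\lambda\in L^2$,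 $\lambda\ge 0$, not identically zero, with $\lambda(I_3-3v\otimes v)\in\mathcal L^2_{st}$; likewise there is none with $\lambda(I_3-v\otimes v)\in\mathcal L^2_{st}$. 2. $$\sup_{\lambda\ge0,\ \|\lambda\|_{L^2}=1}\left\|P_{st}\left(\frac{\lambda}{\sqrt6}(I_3-3v\otimes v)\right)\right\|_{L^2}^2=\frac34 .$$ 3. For every $S\in\mathcal L^2_{st}$, $\|S:(v\otimes v)\|_{L^2}^2\le\frac12\|S\|_{L^2}^2$, and the constant is optimal: the supremum of $\|S:(v\otimes v)\|_{L^2}^2$ over $S\in\mathcal L^2_{st}$ with $\|S\|_{L^2}=1$ is $\frac12$. 4. Let $0<\epsilon<1$ and let $\lambda\in L^2$ (of any sign) satisfy $\|\lambda\|_{L^2}=1$ and $\hat\lambda(\xi)=0$ for almost every $\xi$ outside the set $\left\{\xi:\frac12-\frac\epsilon2<\frac{(v\cdot\xi)^2}{|\xi|^2}<\frac12+\frac\epsilon2\right\}$. Then $$\left\|P_{st}\left(\frac{\lambda}{\sqrt6}(I_3-3v\otimes v)\right)\right\|_{L^2}^2>\frac34(1-\epsilon)^2 .$$ 5. Let $(b_1,b_2,b_3)$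 be an orthonormal basis of $\mathbb R^3$ with $(v\cdot b_3)^2=\frac12$. Then there are real numbers $a_n>0$ and $\lambda_n\in L^2$ ($n\ge1$) with $\|\lambda_n\|_{L^2}=1$, $\lambda_n>0$ almost everywhere, $$\hat\lambda_n(\xi)=a_n\exp\left(-n(b_1\cdot\xi)^2-n(b_2\cdot\xi)^2-\tfrac1n(b_3\cdot\xi)^2\right)\ \text{for almost every }\xi,$$ and $\left\|P_{st}\left(\frac{\lambda_n}{\sqrt6}(I_3-3v\otimes v)\right)\right\|_{L^2}^2\to\frac34$ as $n\to\infty$. -/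

import Mathlib

open MeasureTheory Filter Topology
open scoped ENNReal FourierTransform

noncomputable section

namespace StrainSpace

/-- Physical space `ℝ³` with its Euclidean norm and Lebesgue measure. -/
abbrev E3 := EuclideanSpace ℝ (Fin 3)

/-- `L²(ℝ³; ℝ)`. -/
abbrev L2 := Lp ℝ 2 (volume : Measure E3)

/-- `L²(ℝ³; ℂ)`, where Fourier transforms live; `𝓕` is Mathlib's unitary Fourier transform,
with kernel `exp (-2πi x·ξ)`. -/
abbrev L2C := Lp ℂ 2 (volume : Measure E3)

/-- `L²(ℝ³; ℝ³)`. -/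
abbrev L2vec := Lp E3 2 (volume : Measure E3)

/-- Real symmetric `3 × 3` matrices, with the Frobenius inner product `∑ i j, A i j * B i j`. -/
def Sym3 : Submodule ℝ (EuclideanSpace ℝ (Fin 3 × Fin 3)) where
  carrier := {A | ∀ i j, A (i, j) = A (j, i)}
  add_mem' := fun {A B} hA hB i j => by
    simp only [PiLp.add_apply, hA i j, hB i j]
  zero_mem' := fun i j => by simp
  smul_mem' := fun c A hA i j => by
    simp only [PiLp.smul_apply, hA i j]

/-- `L²(ℝ³; Sym3)`, square integrable symmetric matrix fields. -/
abbrev L2sym := Lp Sym3 2 (volume : Measure E3)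

/-- A real `L²` function seen as a complex one. -/
def toComplex : L2 →L[ℝ] L2C := Complex.ofRealCLM.compLpL 2 volume

/-- The `j`-th component of a vector field. -/
def vecComp (j : Fin 3) : L2vec →L[ℝ] L2 :=
  (EuclideanSpace.proj j : E3 →L[ℝ] ℝ).compLpL 2 volume

/-- The `(i, j)` entry of a symmetric matrix, as a linear map. -/
def entry (i j : Fin 3) : Sym3 →L[ℝ] ℝ :=
  (EuclideanSpace.proj (i, j) : EuclideanSpace ℝ (Fin 3 × Fin 3) →L[ℝ] ℝ).comp Sym3.subtypeL

/-- The `(i, j)` entry of a matrix field. -/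
def matComp (i j : Fin 3) : L2sym →L[ℝ] L2 := (entry i j).compLpL 2 volume

/-- The symbol `i ξⱼ / |ξ|` of `∂ⱼ (-Δ)^{-1/2}`. -/
def rieszSymbol (j : Fin 3) (ξ : E3) : ℂ := Complex.I * ((ξ j / ‖ξ‖ : ℝ) : ℂ)

lemma memLp_rieszSymbol (j : Fin 3) : MemLp (rieszSymbol j) ∞ (volume : Measure E3) := by
  refine memLp_top_of_bound (C := 1) ?_ (Eventually.of_forall fun ξ => ?_)
  · have h : Measurable (rieszSymbol j) := by
      unfold rieszSymbol
      fun_prop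
    exact h.aestronglyMeasurable
  · simp only [rieszSymbol, norm_mul, Complex.norm_I, one_mul, Complex.norm_real, norm_div,
      norm_norm]
    exact div_le_one_of_le₀ (PiLp.norm_apply_le ξ j) (norm_nonneg ξ)

/-- Multiplication by `i ξⱼ / |ξ|` on `L²(ℝ³; ℂ)`. -/
def mulSymbol (j : Fin 3) : L2C →L[ℂ] L2C :=
  (ContinuousLinearMap.mul ℂ ℂ).holderL volume ∞ 2 2 ((memLp_rieszSymbol j).toLp (rieszSymbol j))

/-- The operator `∂ⱼ (-Δ)^{-1/2}` on `L²(ℝ³; ℂ)`, as a Fourier multiplier. -/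
def rieszD (j : Fin 3) : L2C →L[ℂ] L2C :=
  (FourierTransform.fourierInvCLM ℂ L2C).comp ((mulSymbol j).comp (FourierTransform.fourierCLM ℂ L2C))

/-- Divergence free vector fields: `u ∈ L²(ℝ³; ℝ³)` with `∇ · (-Δ)^{-1/2} u = 0`. -/
def divFree : Set L2vec := {u | ∑ j, rieszD j (toComplex (vecComp j u)) = 0}

/-- The strain space: `S ∈ L²(ℝ³; Sym3)` with `S = ∇_sym (-Δ)^{-1/2} u` for some divergence free
`u ∈ L²(ℝ³; ℝ³)`. -/
def strain : Submodule ℝ L2sym where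
  carrier := {S | ∃ u ∈ divFree, ∀ i j, toComplex (matComp i j S) =
    (1 / 2 : ℂ) • (rieszD i (toComplex (vecComp j u)) + rieszD j (toComplex (vecComp i u)))}
  add_mem' := by
    rintro S T ⟨u, hu, hS⟩ ⟨w, hw, hT⟩
    refine ⟨u + w, ?_, fun i j => ?_⟩
    · simp only [divFree, Set.mem_ofPred_eq, map_add, Finset.sum_add_distrib] at hu hw ⊢
      rw [hu, hw, add_zero]
    · simp only [map_add, hS i j, hT i j]
      module
  zero_mem' := ⟨0, by simp [divFree], fun i j => by simp⟩
  smul_mem' := by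
    rintro c S ⟨u, hu, hS⟩
    have hD : ∀ (j : Fin 3) (f : L2C), rieszD j (c • f) = c • rieszD j f := fun j f =>
      LinearMap.map_smul_of_tower (rieszD j).toLinearMap c f
    refine ⟨c • u, ?_, fun i j => ?_⟩
    · simp only [divFree, Set.mem_ofPred_eq, map_smul, hD, ← Finset.smul_sum] at hu ⊢
      rw [hu, smul_zero]
    · simp only [map_smul, hS i j, hD]
      rw [← smul_add, smul_comm]

/- The strain space is closed, so that the orthogonal projection onto it exists. -/

lemma coeFn_mulSymbol (j : Fin 3) (f : L2C) :
    mulSymbol j f =ᵐ[volume] fun ξ => rieszSymbol j ξ * f ξ := by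
  have h1 := (ContinuousLinearMap.mul ℂ ℂ).coeFn_holder (r := 2)
    ((memLp_rieszSymbol j).toLp (rieszSymbol j)) f
  filter_upwards [h1, (memLp_rieszSymbol j).coeFn_toLp] with ξ h2 h3
  rw [h3] at h2
  exact h2

lemma fourier_rieszD (j : Fin 3) (f : L2C) : 𝓕 (rieszD j f) = mulSymbol j (𝓕 f) :=
  FourierTransform.fourier_fourierInv_eq _

lemma mulSymbol_comm (i j : Fin 3) (f : L2C) :
    mulSymbol i (mulSymbol j f) = mulSymbol j (mulSymbol i f) := by
  apply Lp.ext
  filter_upwards [coeFn_mulSymbol i (mulSymbol j f), coeFn_mulSymbol j (mulSymbol i f),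
    coeFn_mulSymbol i f, coeFn_mulSymbol j f] with ξ h1 h2 h3 h4
  rw [h1, h2, h3, h4]
  ring

lemma fourier_injective {f g : L2C} (h : 𝓕 f = 𝓕 g) : f = g :=
  (Lp.fourierTransformₗᵢ E3 ℂ).injective h

lemma rieszD_comm (i j : Fin 3) (f : L2C) : rieszD i (rieszD j f) = rieszD j (rieszD i f) := by
  apply fourier_injective
  simp only [fourier_rieszD]
  exact mulSymbol_comm i j _

lemma sum_rieszD_rieszD (f : L2C) : ∑ j, rieszD j (rieszD j f) = -f := by
  apply fourier_injective
  have h : ∀ g : L2C, 𝓕 g = FourierTransform.fourierCLM ℂ L2C g := fun g => rfl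
  rw [h, h, map_sum, map_neg]
  simp only [← h, fourier_rieszD, Fin.sum_univ_three]
  apply Lp.ext
  have hne : ∀ᵐ ξ : E3, ξ ≠ 0 := by
    simp [ae_iff]
  filter_upwards [hne, Lp.coeFn_neg (𝓕 f),
    Lp.coeFn_add (mulSymbol 0 (mulSymbol 0 (𝓕 f)) + mulSymbol 1 (mulSymbol 1 (𝓕 f)))
      (mulSymbol 2 (mulSymbol 2 (𝓕 f))),
    Lp.coeFn_add (mulSymbol 0 (mulSymbol 0 (𝓕 f))) (mulSymbol 1 (mulSymbol 1 (𝓕 f))),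
    coeFn_mulSymbol 0 (mulSymbol 0 (𝓕 f)), coeFn_mulSymbol 1 (mulSymbol 1 (𝓕 f)),
    coeFn_mulSymbol 2 (mulSymbol 2 (𝓕 f)), coeFn_mulSymbol 0 (𝓕 f), coeFn_mulSymbol 1 (𝓕 f),
    coeFn_mulSymbol 2 (𝓕 f)] with ξ h0 hn ha hb h1 h2 h3 h4 h5 h6
  rw [hn, ha, Pi.add_apply, hb, Pi.add_apply, Pi.neg_apply, h1, h2, h3, h4, h5, h6]
  simp only [rieszSymbol]
  have hpos : (‖ξ‖ : ℝ) ≠ 0 := norm_ne_zero_iff.mpr h0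
  have hs : (ξ 0 / ‖ξ‖) ^ 2 + (ξ 1 / ‖ξ‖) ^ 2 + (ξ 2 / ‖ξ‖) ^ 2 = 1 := by
    have := EuclideanSpace.norm_sq_eq ξ
    simp only [Fin.sum_univ_three, Real.norm_eq_abs, sq_abs] at this
    field_simp
    exact this.symm
  have hs' : ((ξ 0 / ‖ξ‖ : ℝ) : ℂ) ^ 2 + ((ξ 1 / ‖ξ‖ : ℝ) : ℂ) ^ 2
      + ((ξ 2 / ‖ξ‖ : ℝ) : ℂ) ^ 2 = 1 := by
    simpa only [Complex.ofReal_add, Complex.ofReal_pow, Complex.ofReal_one] using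
      congrArg (fun t : ℝ => (t : ℂ)) hs
  linear_combination (Complex.I ^ 2 * (𝓕 f : L2C) ξ) * hs' + ((𝓕 f : L2C) ξ) * Complex.I_sq

/-- `-2 div (-Δ)^{-1/2} S`, which recovers `u` from `S = ∇_sym (-Δ)^{-1/2} u`. -/
def recover (i : Fin 3) (S : L2sym) : L2C :=
  (-2 : ℂ) • ∑ j, rieszD j (toComplex (matComp i j S))

lemma continuous_recover (i : Fin 3) : Continuous (recover i) := by
  unfold recover
  fun_prop

lemma recover_eq {S : L2sym} {u : L2vec} (hu : u ∈ divFree)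
    (hS : ∀ i j, toComplex (matComp i j S) = (1 / 2 : ℂ) •
      (rieszD i (toComplex (vecComp j u)) + rieszD j (toComplex (vecComp i u)))) (i : Fin 3) :
    recover i S = toComplex (vecComp i u) := by
  have hu' : ∑ j, rieszD j (toComplex (vecComp j u)) = 0 := hu
  simp only [recover, hS, map_smul, map_add, smul_add, Finset.sum_add_distrib, ← Finset.smul_sum,
    sum_rieszD_rieszD]
  have : ∑ j, rieszD j (rieszD i (toComplex (vecComp j u))) = 0 := by
    simp only [rieszD_comm _ i, ← map_sum, hu', map_zero]
  rw [this]
  module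

lemma isClosed_range_toComplex : IsClosed (Set.range toComplex) := by
  have h : Isometry toComplex := by
    refine AddMonoidHomClass.isometry_of_norm toComplex fun f => ?_
    rw [Lp.norm_def, Lp.norm_def]
    congr 1
    refine eLpNorm_congr_norm_ae ?_
    filter_upwards [Complex.ofRealCLM.coeFn_compLpL (p := 2) f] with x hx
    change ‖(Complex.ofRealCLM.compLpL 2 volume f) x‖ = _
    rw [hx]
    simp
  exact h.isClosedEmbedding.isClosed_range

/-- The vector field with given components. -/
lemma exists_vec (c : Fin 3 → L2) : ∃ u : L2vec, ∀ i, vecComp i u = c i := by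
  refine ⟨∑ k, (ContinuousLinearMap.toSpanSingleton ℝ
    (EuclideanSpace.single k (1 : ℝ) : E3)).compLpL 2 volume (c k), fun i => ?_⟩
  rw [map_sum, Finset.sum_eq_single i]
  · apply Lp.ext
    refine (ContinuousLinearMap.coeFn_compLpL _ _).trans ?_
    filter_upwards [(ContinuousLinearMap.toSpanSingleton ℝ
      (EuclideanSpace.single i (1 : ℝ) : E3)).coeFn_compLpL (p := 2) (c i)] with x hx
    rw [hx]
    simp
  · intro k _ hk
    apply Lp.ext
    refine (ContinuousLinearMap.coeFn_compLpL _ _).trans ?_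
    filter_upwards [(ContinuousLinearMap.toSpanSingleton ℝ
      (EuclideanSpace.single k (1 : ℝ) : E3)).coeFn_compLpL (p := 2) (c k),
      Lp.coeFn_zero ℝ 2 (volume : Measure E3)] with x hx h0
    rw [hx, h0]
    simp [hk.symm]
  · simp

lemma isClosed_strain : IsClosed (strain : Set L2sym) := by
  have h : (strain : Set L2sym) = {S | (∀ i, recover i S ∈ Set.range toComplex) ∧
      ∑ i, rieszD i (recover i S) = 0 ∧ ∀ i j, toComplex (matComp i j S) =
        (1 / 2 : ℂ) • (rieszD i (recover j S) + rieszD j (recover i S))} := by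
    ext S
    constructor
    · rintro ⟨u, hu, hS⟩
      have hr := recover_eq hu hS
      simp only [Set.mem_ofPred_eq, hr]
      exact ⟨fun i => ⟨_, rfl⟩, hu, hS⟩
    · rintro ⟨h1, h2, h3⟩
      choose c hc using h1
      obtain ⟨u, hu⟩ := exists_vec c
      refine ⟨u, ?_, fun i j => ?_⟩
      · simpa only [divFree, Set.mem_ofPred_eq, hu, hc] using h2
      · simpa only [hu, hc] using h3 i j
  rw [h]
  simp only [Set.ofPred_and, Set.ofPred_forall]
  have hr := continuous_recover
  refine (isClosed_iInter fun i => isClosed_range_toComplex.preimage (hr i)).inter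
    ((isClosed_eq (by fun_prop) (by fun_prop)).inter
      (isClosed_iInter fun i => isClosed_iInter fun j => isClosed_eq (by fun_prop) (by fun_prop)))

instance : CompleteSpace strain := isClosed_strain.completeSpace_coe

/-- The orthogonal projection of `L²(ℝ³; Sym3)` onto the strain space. -/
def Pst : L2sym →L[ℝ] L2sym := Submodule.starProjection (𝕜 := ℝ) (E := L2sym) strain

/-- The constant symmetric matrix `I₃ - c v ⊗ v`. -/
def axialMatrix (c : ℝ) (v : E3) : Sym3 :=
  ⟨WithLp.toLp 2 fun p => (if p.1 = p.2 then 1 else 0) - c * (v p.1 * v p.2), fun i j => by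
    simp only [eq_comm, mul_comm]⟩

/-- The matrix field `lam (I₃ - c v ⊗ v)`. -/
def axialField (c : ℝ) (v : E3) (lam : L2) : L2sym :=
  (ContinuousLinearMap.toSpanSingleton ℝ (axialMatrix c v)).compLpL 2 volume lam

/-- The unit-normalised matrix field `(lam / √6) (I₃ - 3 v ⊗ v)`. -/
def compression (v : E3) (lam : L2) : L2sym := (√6)⁻¹ • axialField 3 v lam

/-- The scalar field `S : (v ⊗ v) = ∑ i j, v i * v j * S i j`. -/
def doubleDot (v : E3) (S : L2sym) : L2 := ∑ i, ∑ j, (v i * v j) • matComp i j S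

/-- The Fourier transform of a real `L²` function. -/
def fourierReal (lam : L2) : L2C := 𝓕 (toComplex lam)

/-- The open double-cone region `1/2 - ε/2 < (v·ξ)² / |ξ|² < 1/2 + ε/2`. -/
def coneRegion (v : E3) (ε : ℝ) : Set E3 :=
  {ξ | 1 / 2 - ε / 2 < inner ℝ v ξ ^ 2 / ‖ξ‖ ^ 2 ∧ inner ℝ v ξ ^ 2 / ‖ξ‖ ^ 2 < 1 / 2 + ε / 2}

/-- The Gaussian `exp (-n (b₀·ξ)² - n (b₁·ξ)² - (b₂·ξ)² / n)`, which concentrates along `b₂` as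
`n → ∞`. -/
def gaussianProfile (b : OrthonormalBasis (Fin 3) ℝ E3) (n : ℕ) (ξ : E3) : ℝ :=
  Real.exp (-n * inner ℝ (b 0) ξ ^ 2 - n * inner ℝ (b 1) ξ ^ 2 - 1 / n * inner ℝ (b 2) ξ ^ 2)

end StrainSpace

end

open StrainSpace

noncomputable section

namespace StrainSpace

/-! ### The Fourier transform on `L²`: real functions and integrable functions -/

/-! Write R_j for `riesz j` and T = v · R for `dirRiesz v`. These operators are skew-adjoint, they
commute, and Σ R_j R_j = -1. On the Fourier side T is multiplication by i cos θ, where θ is the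
angle between v and ξ.

The strain space is orthogonal to every field whose row divergences form a gradient
(`inner_eq_zero_of_mem_strain`). This identifies the projection of f (I₃ - c v ⊗ v) explicitly
(`exists_mem_strain_axial`, `Pst_axialField`). Its squared norm is -2c² ⟨f, (T² + T⁴) f⟩, that is,
the integral of 2c² cos²θ sin²θ |f̂|². Completing the square gives `norm_sq_Pst_axialField`: the
value is 2c² (‖f‖²/4 - ‖(T² + 1/2) f‖²).

Everything follows from this identity. Dropping the negative square gives the upper bounds, and the
loss is small exactly when f̂ lives near the cone cos²θ = 1/2. A positive f cannot simply be cut off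
in frequency, so Gaussians are stretched along a direction of that cone; a linear change of
variables and dominated convergence show that the loss vanishes. The bound on S : (v ⊗ v) is the
dual statement, since f ↦ -Pst (f (I₃ - v ⊗ v)) is the adjoint of S ↦ S : (v ⊗ v) on strains. -/

/-- The `L²` Fourier transform of a function in `L¹ ∩ L²` is given by the Fourier integral. -/
lemma fourier_toLp_ae_eq {f : E3 → ℂ} (hf : Integrable f) (hf2 : MemLp f 2) :
    (𝓕 (hf2.toLp f) : L2C) =ᵐ[volume] 𝓕 f := by
  have hcont : Continuous (𝓕 f) :=
    VectorFourier.fourierIntegral_continuous Real.continuous_fourierChar continuous_inner hf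
  refine ae_eq_of_integral_contDiff_smul_eq ((Lp.memLp _).locallyIntegrable (by norm_num))
    hcont.locallyIntegrable fun g hg hc => ?_
  have hg₁ : HasCompactSupport (Complex.ofRealCLM ∘ g) := hc.comp_left rfl
  have hg₂ : ContDiff ℝ ((⊤ : ℕ∞) : WithTop ℕ∞) (Complex.ofRealCLM ∘ g) :=
    Complex.ofRealCLM.contDiff.comp hg
  set G : SchwartzMap E3 ℂ := hg₁.toSchwartzMap hg₂ with hG
  have hGg : ∀ x, G x = (g x : ℂ) := fun x => rfl
  -- The `L²` transform agrees with the distributional one, which moves 𝓕 onto the test function;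
  -- Fubini then moves it back onto f.
  have h1 := congrArg (fun T => T G) (Lp.fourier_toTemperedDistribution_eq (hf2.toLp f))
  simp only [TemperedDistribution.fourier_apply, Lp.toTemperedDistribution_apply] at h1
  have h2 : ∫ x, 𝓕 (G : E3 → ℂ) x • f x = ∫ x, G x • 𝓕 f x := by
    simpa using! (VectorFourier.integral_fourierIntegral_smul_eq_flip (L := innerₗ E3)
      Real.continuous_fourierChar continuous_inner G.integrable hf)
  calc ∫ x, g x • (𝓕 (hf2.toLp f) : L2C) x
      = ∫ x, G x • (𝓕 (hf2.toLp f) : L2C) x := by simp [hGg]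
    _ = ∫ x, (𝓕 G) x • (hf2.toLp f : L2C) x := h1.symm
    _ = ∫ x, 𝓕 (G : E3 → ℂ) x • f x := by
        refine integral_congr_ae ?_
        filter_upwards [hf2.coeFn_toLp] with x hx
        rw [hx, SchwartzMap.fourier_coe]
    _ = ∫ x, g x • 𝓕 f x := by
        rw [h2]
        simp [hGg]

/-- Complex conjugation on `L²(ℝ³; ℂ)`. -/
def conjL : L2C →L[ℝ] L2C := (Complex.conjCLE : ℂ →L[ℝ] ℂ).compLpL 2 volume

/-- The reflection `f ↦ f (-·)` on `L²(ℝ³; ℂ)`. -/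
def reflectL : L2C →ₗᵢ[ℝ] L2C :=
  Lp.compMeasurePreservingₗᵢ ℝ (fun x : E3 => -x) (Measure.measurePreserving_neg volume)

lemma coeFn_conjL (f : L2C) : conjL f =ᵐ[volume] fun x => (starRingEnd ℂ) (f x) :=
  ContinuousLinearMap.coeFn_compLpL _ f

lemma coeFn_reflectL (f : L2C) : reflectL f =ᵐ[volume] fun x => f (-x) :=
  Lp.coeFn_compMeasurePreserving f (Measure.measurePreserving_neg volume)

lemma ae_comp_neg {p : E3 → Prop} (h : ∀ᵐ x : E3, p x) : ∀ᵐ x : E3, p (-x) :=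
  (Measure.measurePreserving_neg (volume : Measure E3)).quasiMeasurePreserving.ae h

lemma fourier_conj_apply (f : E3 → ℂ) (ξ : E3) :
    𝓕 (fun x => (starRingEnd ℂ) (f x)) ξ = (starRingEnd ℂ) (𝓕 f (-ξ)) := by
  rw [Real.fourier_eq, Real.fourier_eq, ← integral_conj]
  congr 1
  ext x
  simp [Circle.smul_def, ← Circle.coe_inv_eq_conj, ← AddChar.map_neg_eq_inv]

/-- Both sides are continuous in f, so it suffices to check Schwartz functions, where the Fourier
integral is available. This is what shows that the multipliers preserve real functions. -/
lemma fourier_conjL (f : L2C) : 𝓕 (conjL f) = conjL (reflectL (𝓕 f)) := by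
  refine DenseRange.induction_on (p := fun f : L2C => 𝓕 (conjL f) = conjL (reflectL (𝓕 f)))
    (SchwartzMap.denseRange_toLpCLM (E := E3) (F := ℂ) (p := 2) (μ := volume)
      ENNReal.ofNat_ne_top) f ?_ fun φ => ?_
  · have hF : Continuous (fun f : L2C => (𝓕 f : L2C)) :=
      (Lp.fourierTransformₗᵢ E3 ℂ).continuous
    exact isClosed_eq (hF.comp conjL.continuous)
      (conjL.continuous.comp (reflectL.continuous.comp hF))
  · change 𝓕 (conjL (φ.toLp 2)) = conjL (reflectL (𝓕 (φ.toLp 2)))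
    have hint : Integrable (fun x => (starRingEnd ℂ) (φ x)) :=
      (Complex.conjCLE : ℂ →L[ℝ] ℂ).integrable_comp φ.integrable
    have hmem : MemLp (fun x => (starRingEnd ℂ) (φ x)) 2 := (φ.memLp 2 volume).star
    have h1 : conjL (φ.toLp 2) = hmem.toLp _ := by
      apply Lp.ext
      filter_upwards [coeFn_conjL (φ.toLp 2), hmem.coeFn_toLp, φ.coeFn_toLp 2 volume]
        with x h1 h2 h3
      rw [h1, h2, h3]
    rw [h1, SchwartzMap.toLp_fourier_eq]
    apply Lp.ext
    filter_upwards [fourier_toLp_ae_eq hint hmem, coeFn_conjL (reflectL ((𝓕 φ).toLp 2)),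
      coeFn_reflectL ((𝓕 φ).toLp 2), ae_comp_neg ((𝓕 φ).coeFn_toLp 2 volume)] with x h1 h2 h3 h4
    rw [h1, h2, h3, h4, fourier_conj_apply, SchwartzMap.fourier_coe]

/-- The symbol is i times a real odd function; this Hermitian symmetry is the Fourier-side form of
mapping real functions to real functions. -/
lemma rieszSymbol_neg_conj (j : Fin 3) (ξ : E3) :
    (starRingEnd ℂ) (rieszSymbol j (-ξ)) = rieszSymbol j ξ := by
  simp [rieszSymbol, neg_div]

lemma mulSymbol_conjL_reflectL (j : Fin 3) (f : L2C) :
    mulSymbol j (conjL (reflectL f)) = conjL (reflectL (mulSymbol j f)) := by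
  apply Lp.ext
  filter_upwards [coeFn_mulSymbol j (conjL (reflectL f)), coeFn_conjL (reflectL f),
    coeFn_reflectL f, coeFn_conjL (reflectL (mulSymbol j f)), coeFn_reflectL (mulSymbol j f),
    ae_comp_neg (coeFn_mulSymbol j f)] with ξ h1 h2 h3 h4 h5 h6
  rw [h1, h2, h3, h4, h5, h6, map_mul, rieszSymbol_neg_conj]

lemma rieszD_conjL (j : Fin 3) (f : L2C) : rieszD j (conjL f) = conjL (rieszD j f) := by
  apply fourier_injective
  rw [fourier_rieszD, fourier_conjL, fourier_conjL, fourier_rieszD, mulSymbol_conjL_reflectL]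

lemma coeFn_toComplex (f : L2) : toComplex f =ᵐ[volume] fun x => (f x : ℂ) :=
  ContinuousLinearMap.coeFn_compLpL _ f

lemma toComplex_injective : Function.Injective toComplex := by
  intro f g h
  apply Lp.ext
  filter_upwards [coeFn_toComplex f, coeFn_toComplex g] with x h1 h2
  rw [h, h2] at h1
  exact_mod_cast h1.symm

lemma conjL_toComplex (f : L2) : conjL (toComplex f) = toComplex f := by
  apply Lp.ext
  filter_upwards [coeFn_conjL (toComplex f), coeFn_toComplex f] with x h1 h2
  rw [h1, h2, Complex.conj_ofReal]

/-- The real part on `L²(ℝ³; ℂ)`. -/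
def reL : L2C →L[ℝ] L2 := Complex.reCLM.compLpL 2 volume

lemma toComplex_reL {f : L2C} (hf : conjL f = f) : toComplex (reL f) = f := by
  apply Lp.ext
  filter_upwards [coeFn_toComplex (reL f), Complex.reCLM.coeFn_compLpL (p := 2) f,
    coeFn_conjL f] with x h1 h2 h3
  rw [hf] at h3
  rw [h1]
  change ((reL f : L2) x) = _ at h2
  rw [h2]
  exact Complex.conj_eq_iff_re.mp h3.symm

/-! ### The real operators `∂ⱼ (-Δ)^{-1/2}` -/

/-- The operator `∂ⱼ (-Δ)^{-1/2}` on `L²(ℝ³; ℝ)`. -/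
def riesz (j : Fin 3) : L2 →L[ℝ] L2 := reL.comp (((rieszD j).restrictScalars ℝ).comp toComplex)

/-- Taking the real part in `riesz` loses nothing, because `rieszD j` commutes with conjugation. -/
lemma toComplex_riesz (j : Fin 3) (f : L2) : toComplex (riesz j f) = rieszD j (toComplex f) :=
  toComplex_reL ((rieszD_conjL j _).symm.trans (congrArg (rieszD j) (conjL_toComplex f)))

lemma riesz_comm (i j : Fin 3) (f : L2) : riesz i (riesz j f) = riesz j (riesz i f) := by
  apply toComplex_injective
  simp only [toComplex_riesz]
  exact rieszD_comm i j _

lemma sum_riesz_riesz (f : L2) : ∑ j, riesz j (riesz j f) = -f := by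
  apply toComplex_injective
  simp only [map_sum, toComplex_riesz, map_neg]
  exact sum_rieszD_rieszD _

lemma re_inner_toComplex (f g : L2) :
    (inner ℂ (toComplex f) (toComplex g)).re = inner ℝ f g := by
  have h : inner ℂ (toComplex f) (toComplex g) = ((inner ℝ f g : ℝ) : ℂ) := by
    rw [L2.inner_def, L2.inner_def, ← integral_complex_ofReal]
    refine integral_congr_ae ?_
    filter_upwards [coeFn_toComplex f, coeFn_toComplex g] with x h1 h2
    rw [h1, h2]
    simp
  rw [h, Complex.ofReal_re]

lemma inner_mulSymbol (j : Fin 3) (f g : L2C) :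
    inner ℂ (mulSymbol j f) g = -inner ℂ f (mulSymbol j g) := by
  rw [L2.inner_def, L2.inner_def, ← integral_neg]
  refine integral_congr_ae ?_
  filter_upwards [coeFn_mulSymbol j f, coeFn_mulSymbol j g] with ξ h1 h2
  rw [h1, h2]
  simp [rieszSymbol]
  ring

/-- Plancherel, together with the symbol being purely imaginary. -/
lemma inner_riesz (j : Fin 3) (f g : L2) : inner ℝ (riesz j f) g = -inner ℝ f (riesz j g) := by
  rw [← re_inner_toComplex, ← re_inner_toComplex, toComplex_riesz, toComplex_riesz,
    ← Lp.inner_fourier_eq, fourier_rieszD, inner_mulSymbol, Complex.neg_re, ← fourier_rieszD,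
    Lp.inner_fourier_eq]

lemma norm_fourierReal (f : L2) : ‖fourierReal f‖ = ‖f‖ := by
  have h := re_inner_toComplex f f
  rw [← sq_eq_sq₀ (norm_nonneg _) (norm_nonneg _), fourierReal, Lp.norm_fourier_eq,
    ← real_inner_self_eq_norm_sq f, ← h]
  exact (inner_self_eq_norm_sq (𝕜 := ℂ) _).symm

lemma coeFn_fourierReal_riesz (j : Fin 3) (f : L2) :
    fourierReal (riesz j f) =ᵐ[volume] fun ξ => rieszSymbol j ξ * fourierReal f ξ := by
  rw [fourierReal, toComplex_riesz, fourier_rieszD]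
  exact coeFn_mulSymbol j _

/-! ### Symmetric matrix fields through their entries -/

lemma coeFn_matComp (i j : Fin 3) (S : L2sym) :
    matComp i j S =ᵐ[volume] fun x => (S x : EuclideanSpace ℝ (Fin 3 × Fin 3)) (i, j) :=
  ContinuousLinearMap.coeFn_compLpL _ S

lemma matComp_symm (i j : Fin 3) (S : L2sym) : matComp i j S = matComp j i S := by
  apply Lp.ext
  filter_upwards [coeFn_matComp i j S, coeFn_matComp j i S] with x h1 h2
  rw [h1, h2]
  exact (S x).2 i j

lemma inner_eq_sum_matComp (S T : L2sym) :
    inner ℝ S T = ∑ i, ∑ j, inner ℝ (matComp i j S) (matComp i j T) := by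
  have h : ∀ p : Fin 3 × Fin 3,
      Integrable (fun x => inner ℝ (matComp p.1 p.2 S x) (matComp p.1 p.2 T x)) volume :=
    fun p => L2.integrable_inner _ _
  rw [← Fintype.sum_prod_type' (f := fun i j => inner ℝ (matComp i j S) (matComp i j T))]
  simp only [L2.inner_def]
  rw [← integral_finsetSum _ fun p _ => h p]
  refine integral_congr_ae ?_
  have hS : ∀ᵐ x : E3, ∀ p : Fin 3 × Fin 3, matComp p.1 p.2 S x =
      (S x : EuclideanSpace ℝ (Fin 3 × Fin 3)) (p.1, p.2) :=
    ae_all_iff.mpr fun p => coeFn_matComp p.1 p.2 S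
  have hT : ∀ᵐ x : E3, ∀ p : Fin 3 × Fin 3, matComp p.1 p.2 T x =
      (T x : EuclideanSpace ℝ (Fin 3 × Fin 3)) (p.1, p.2) :=
    ae_all_iff.mpr fun p => coeFn_matComp p.1 p.2 T
  filter_upwards [hS, hT] with x h1 h2
  simp only [h1, h2, Submodule.coe_inner, PiLp.inner_apply]

/-- The matrix field `f B` for a constant matrix `B`. -/
lemma matComp_toSpanSingleton (i j : Fin 3) (B : Sym3) (f : L2) :
    matComp i j ((ContinuousLinearMap.toSpanSingleton ℝ B).compLpL 2 volume f) =
      entry i j B • f := by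
  apply Lp.ext
  refine (ContinuousLinearMap.coeFn_compLpL _ _).trans ?_
  filter_upwards [(ContinuousLinearMap.toSpanSingleton ℝ B).coeFn_compLpL (p := 2) f,
    Lp.coeFn_smul (entry i j B) f] with x h1 h2
  rw [h1, h2]
  simp [mul_comm]

lemma matComp_axialField (i j : Fin 3) (c : ℝ) (v : E3) (f : L2) :
    matComp i j (axialField c v f) = ((if i = j then 1 else 0) - c * (v i * v j)) • f :=
  matComp_toSpanSingleton i j _ f

/-- The symmetric matrix `(eᵢ ⊗ eⱼ + eⱼ ⊗ eᵢ) / 2`. -/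
def symUnit (i j : Fin 3) : Sym3 :=
  ⟨WithLp.toLp 2 fun p => 1 / 2 * ((if p.1 = i ∧ p.2 = j then 1 else 0) +
    if p.2 = i ∧ p.1 = j then 1 else 0), fun k l => by simp only [add_comm]⟩

lemma entry_symUnit (k l i j : Fin 3) : entry k l (symUnit i j) =
    1 / 2 * ((if k = i ∧ l = j then 1 else 0) + if l = i ∧ k = j then 1 else 0) := rfl

/-- The symmetric matrix field with given entries. -/
lemma exists_matComp_eq (c : Fin 3 → Fin 3 → L2) (hc : ∀ i j, c i j = c j i) :
    ∃ S : L2sym, ∀ i j, matComp i j S = c i j := by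
  refine ⟨∑ i, ∑ j, (ContinuousLinearMap.toSpanSingleton ℝ (symUnit i j)).compLpL 2 volume
    (c i j), fun k l => ?_⟩
  simp only [map_sum, matComp_toSpanSingleton, entry_symUnit, mul_add, add_smul, ite_and,
    mul_ite, mul_one, mul_zero, ite_smul, zero_smul, Finset.sum_add_distrib, Finset.sum_ite_eq,
    Finset.sum_const_zero, Finset.mem_univ, if_true, Finset.sum_ite_irrel]
  rw [hc l k]
  module

/-! ### The strain space and its projection on axial fields -/

/-- Brings the definition down from complex to real functions, so that the remaining algebra uses
only the operators `riesz j`. -/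
lemma mem_strain_iff {S : L2sym} : S ∈ strain ↔ ∃ u : Fin 3 → L2, ∑ j, riesz j (u j) = 0 ∧
    ∀ i j, matComp i j S = (1 / 2 : ℝ) • (riesz i (u j) + riesz j (u i)) := by
  have hdiv : ∀ u : L2vec, u ∈ divFree ↔ ∑ j, riesz j (vecComp j u) = 0 := fun u => by
    rw [← toComplex_injective.eq_iff]
    simp only [map_sum, toComplex_riesz, map_zero]
    rfl
  have hsym : ∀ (f g h : L2), toComplex f = (1 / 2 : ℂ) • (toComplex g + toComplex h) ↔
      f = (1 / 2 : ℝ) • (g + h) := fun f g h => by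
    rw [← toComplex_injective.eq_iff, map_smul, map_add,
      RCLike.real_smul_eq_coe_smul (K := ℂ) (1 / 2 : ℝ) (toComplex g + toComplex h)]
    norm_num
  constructor
  · rintro ⟨u, hu, hS⟩
    refine ⟨fun j => vecComp j u, (hdiv u).mp hu, fun i j => ?_⟩
    rw [← hsym, toComplex_riesz, toComplex_riesz]
    exact hS i j
  · rintro ⟨w, hw, hS⟩
    obtain ⟨u, hu⟩ := exists_vec w
    refine ⟨u, (hdiv u).mpr (by simpa only [hu] using hw), fun i j => ?_⟩
    rw [hu, hu, ← toComplex_riesz, ← toComplex_riesz, hsym]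
    exact hS i j

/-- The trace of a symmetric gradient is the divergence, which vanishes here. -/
lemma sum_matComp_diag_of_mem_strain {S : L2sym} (hS : S ∈ strain) : ∑ i, matComp i i S = 0 := by
  obtain ⟨u, hu, h⟩ := mem_strain_iff.mp hS
  simp only [h, ← Finset.smul_sum, Finset.sum_add_distrib, hu, add_zero, smul_zero]

/-- A field whose row divergences form a gradient is orthogonal to the strain space. -/
lemma inner_eq_zero_of_mem_strain {D S : L2sym} (hS : S ∈ strain) (g : L2)
    (hD : ∀ j, ∑ i, riesz i (matComp i j D) = riesz j g) : inner ℝ D S = 0 := by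
  obtain ⟨u, hu, h⟩ := mem_strain_iff.mp hS
  have h1 : ∑ i, ∑ j, inner ℝ (matComp i j D) (riesz i (u j)) = 0 := by
    rw [Finset.sum_comm]
    -- Skew-adjointness moves `riesz i` onto D, where the sum over i is the gradient of g, and then
    -- `riesz j` back onto u, where the sum over j is a divergence.
    have : ∀ j, ∑ i, inner ℝ (matComp i j D) (riesz i (u j)) = inner ℝ g (riesz j (u j)) :=
      fun j => by
        simp only [← neg_eq_iff_eq_neg.mpr (inner_riesz _ _ _), Finset.sum_neg_distrib,
          ← sum_inner, hD]
    simp only [this, ← inner_sum, hu, inner_zero_right]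
  have h2 : ∑ i, ∑ j, inner ℝ (matComp i j D) (riesz j (u i)) = 0 := by
    rw [Finset.sum_comm, ← h1]
    exact Finset.sum_congr rfl fun i _ => Finset.sum_congr rfl fun j _ => by
      rw [matComp_symm]
  simp only [inner_eq_sum_matComp, h, inner_smul_right, inner_add_right, ← Finset.mul_sum,
    Finset.sum_add_distrib, h1, h2, add_zero, mul_zero]

/-- The operator `v · ∇ (-Δ)^{-1/2}` on `L²(ℝ³; ℝ)`. -/
def dirRiesz (v : E3) : L2 →L[ℝ] L2 := ∑ j, v j • riesz j

lemma dirRiesz_apply (v : E3) (f : L2) : dirRiesz v f = ∑ j, v j • riesz j f := by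
  simp [dirRiesz]

lemma riesz_dirRiesz (v : E3) (i : Fin 3) (f : L2) :
    riesz i (dirRiesz v f) = dirRiesz v (riesz i f) := by
  simp only [dirRiesz_apply, map_sum, map_smul, riesz_comm i]

lemma inner_dirRiesz (v : E3) (f g : L2) :
    inner ℝ (dirRiesz v f) g = -inner ℝ f (dirRiesz v g) := by
  simp only [dirRiesz_apply, sum_inner, inner_sum, real_inner_smul_left, real_inner_smul_right,
    inner_riesz, mul_neg, Finset.sum_neg_distrib]

lemma doubleDot_apply (v : E3) (S : L2sym) :
    doubleDot v S = ∑ i, ∑ j, (v i * v j) • matComp i j S := rfl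

/-- On strains, `I₃ - c v ⊗ v` acts as `-c v ⊗ v`. -/
lemma inner_axialField_of_mem_strain {S : L2sym} (hS : S ∈ strain) (c : ℝ) (v : E3) (f : L2) :
    inner ℝ (axialField c v f) S = -c * inner ℝ f (doubleDot v S) := by
  have h : ∑ i, ∑ j, (if i = j then (1 : ℝ) else 0) * inner ℝ f (matComp i j S) = 0 := by
    simp only [ite_mul, one_mul, zero_mul, Finset.sum_ite_eq, Finset.mem_univ, if_true,
      ← inner_sum, sum_matComp_diag_of_mem_strain hS, inner_zero_right]
  simp only [inner_eq_sum_matComp, matComp_axialField, real_inner_smul_left, sub_mul,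
    Finset.sum_sub_distrib, h, doubleDot_apply, inner_sum, real_inner_smul_right, Finset.mul_sum]
  simp only [zero_sub, neg_mul, Finset.sum_neg_distrib, mul_assoc]

lemma sum_sq_eq_one {v : E3} (hv : ‖v‖ = 1) : ∑ i, v i * v i = 1 := by
  have := EuclideanSpace.norm_sq_eq v
  rw [hv] at this
  simpa [← sq] using this.symm

/-- The strain that will turn out to be the projection of `f (I₃ - c v ⊗ v)`. -/
lemma exists_mem_strain_axial {v : E3} (c : ℝ) (f : L2) : ∃ S ∈ strain, ∀ i j, matComp i j S =
    c • (v j • riesz i (dirRiesz v f) + v i • riesz j (dirRiesz v f) +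
      (2 : ℝ) • riesz i (riesz j (dirRiesz v (dirRiesz v f)))) := by
  obtain ⟨S, hS⟩ := exists_matComp_eq (fun i j => c • (v j • riesz i (dirRiesz v f) +
    v i • riesz j (dirRiesz v f) + (2 : ℝ) • riesz i (riesz j (dirRiesz v (dirRiesz v f)))))
    fun i j => by rw [riesz_comm i j, add_comm (v j • _)]
  -- The potential is 2c times the Helmholtz projection of v T f: the divergence of v T f is T² f,
  -- and the gradient term cancels it because Σ R_k R_k = -1.
  refine ⟨S, mem_strain_iff.mpr ⟨fun k => (2 * c) • (v k • dirRiesz v f +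
    riesz k (dirRiesz v (dirRiesz v f))), ?_, fun i j => ?_⟩, hS⟩
  · simp only [map_smul, map_add, ← Finset.smul_sum, Finset.sum_add_distrib, sum_riesz_riesz,
      ← dirRiesz_apply, add_neg_cancel, smul_zero]
  · simp only [hS, map_smul, map_add, riesz_comm j i]
    module

/-- Contraction with v ⊗ v turns each R_i into T and each free factor v_i into |v|² = 1. -/
lemma doubleDot_axial {v : E3} (hv : ‖v‖ = 1) {c : ℝ} {f : L2} {S : L2sym}
    (hS : ∀ i j, matComp i j S = c • (v j • riesz i (dirRiesz v f) +
      v i • riesz j (dirRiesz v f) +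
      (2 : ℝ) • riesz i (riesz j (dirRiesz v (dirRiesz v f))))) :
    doubleDot v S = (2 * c) • (dirRiesz v (dirRiesz v f) +
      dirRiesz v (dirRiesz v (dirRiesz v (dirRiesz v f)))) := by
  set g := dirRiesz v f
  have h1 : ∑ i, ∑ j, (v i * v j * (c * v j)) • riesz i g = c • dirRiesz v g := by
    have : ∀ i j, (v i * v j * (c * v j)) • riesz i g = (v j * v j) • (c * v i) • riesz i g :=
      fun i j => by module
    have hsum : ∀ h : L2, ∑ j, (v j * v j) • h = h := fun h => by
      rw [← Finset.sum_smul, sum_sq_eq_one hv, one_smul]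
    simp only [this, hsum, dirRiesz_apply v g, Finset.smul_sum]
    simp only [smul_smul]
  have h2 : ∑ i, ∑ j, (v i * v j * (c * v i)) • riesz j g = c • dirRiesz v g := by
    rw [Finset.sum_comm, ← h1]
    exact Finset.sum_congr rfl fun i _ => Finset.sum_congr rfl fun j _ => by module
  have h3 : ∑ i, ∑ j, (v i * v j * (c * 2)) • riesz i (riesz j (dirRiesz v g)) =
      (2 * c) • dirRiesz v (dirRiesz v (dirRiesz v g)) := by
    rw [dirRiesz_apply v (dirRiesz v (dirRiesz v g)), dirRiesz_apply v (dirRiesz v g)]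
    simp only [map_sum, map_smul, Finset.smul_sum, smul_smul]
    exact Finset.sum_congr rfl fun i _ => Finset.sum_congr rfl fun j _ => by module
  simp only [doubleDot_apply, hS, smul_add, smul_smul, Finset.sum_add_distrib]
  rw [h1, h2, h3]
  module

lemma Pst_axialField {v : E3} {c : ℝ} {f : L2} {S : L2sym} (hmem : S ∈ strain)
    (hS : ∀ i j, matComp i j S = c • (v j • riesz i (dirRiesz v f) +
      v i • riesz j (dirRiesz v f) +
      (2 : ℝ) • riesz i (riesz j (dirRiesz v (dirRiesz v f))))) :
    Pst (axialField c v f) = S := by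
  refine Submodule.eq_starProjection_of_mem_of_inner_eq_zero hmem fun S' hS' => ?_
  -- The row divergences of the residual are R_j f + c R_j T² f: the terms c v_j T f cancel, and the
  -- T² terms combine as -1 + 2 = 1. Hence this choice of g.
  refine inner_eq_zero_of_mem_strain hS' (f + c • dirRiesz v (dirRiesz v f)) fun j => ?_
  set g := dirRiesz v f with hg
  have h1 : ∑ i, (if i = j then (1 : ℝ) else 0) • riesz i f = riesz j f := by simp
  have h2 : ∑ i, (c * (v i * v j)) • riesz i f = (c * v j) • g := by
    rw [hg, dirRiesz_apply, Finset.smul_sum]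
    exact Finset.sum_congr rfl fun i _ => by module
  have h3 : ∑ i, v i • riesz i (riesz j g) = riesz j (dirRiesz v g) := by
    rw [← dirRiesz_apply]
    exact (riesz_dirRiesz v j g).symm
  have h4 : ∑ i, riesz i (riesz i (riesz j (dirRiesz v g))) = -riesz j (dirRiesz v g) :=
    sum_riesz_riesz _
  have h5 : ∑ i, v j • riesz i (riesz i g) = -(v j • g) := by
    rw [← Finset.smul_sum, sum_riesz_riesz, smul_neg]
  simp only [map_sub, matComp_axialField, hS, map_smul, map_add, Finset.sum_sub_distrib, sub_smul,
    ← Finset.smul_sum, Finset.sum_add_distrib, h1, h2, h3, h4, h5]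
  module

lemma inner_Pst {S : L2sym} (hS : S ∈ strain) (F : L2sym) :
    inner ℝ (Pst F) S = inner ℝ F S := by
  have h := Submodule.inner_starProjection_left_eq_right (𝕜 := ℝ) (E := L2sym) strain F S
  rw [(Submodule.starProjection_eq_self_iff (𝕜 := ℝ) (E := L2sym) (K := strain)).mpr hS] at h
  exact h

lemma Pst_mem_strain (F : L2sym) : Pst F ∈ strain :=
  Submodule.starProjection_apply_mem (𝕜 := ℝ) (E := L2sym) strain F

/-- The projection of an axial field, in terms of `T = v · ∇ (-Δ)^{-1/2}`. -/
lemma norm_sq_Pst_axialField {v : E3} (hv : ‖v‖ = 1) (c : ℝ) (f : L2) :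
    ‖Pst (axialField c v f)‖ ^ 2 = 2 * c ^ 2 * (1 / 4 * ‖f‖ ^ 2 -
      ‖dirRiesz v (dirRiesz v f) + (1 / 2 : ℝ) • f‖ ^ 2) := by
  obtain ⟨S, hmem, hS⟩ := exists_mem_strain_axial (v := v) c f
  have hP := Pst_axialField hmem hS
  have h1 : ‖S‖ ^ 2 = -c * inner ℝ f (doubleDot v S) := by
    rw [← inner_axialField_of_mem_strain hmem, ← inner_Pst hmem, hP]
    exact (real_inner_self_eq_norm_sq S).symm
  have h2 : inner ℝ f (dirRiesz v (dirRiesz v (dirRiesz v (dirRiesz v f)))) =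
      ‖dirRiesz v (dirRiesz v f)‖ ^ 2 := by
    rw [← real_inner_self_eq_norm_sq (dirRiesz v (dirRiesz v f)), inner_dirRiesz, inner_dirRiesz,
      neg_neg]
  -- Completing the square, with a = T² f and b = T⁴ f.
  have h3 : ∀ a b : L2, inner ℝ f b = ‖a‖ ^ 2 → -c * inner ℝ f ((2 * c) • (a + b)) =
      2 * c ^ 2 * (1 / 4 * ‖f‖ ^ 2 - ‖a + (1 / 2 : ℝ) • f‖ ^ 2) := fun a b hb => by
    rw [norm_add_sq_real, norm_smul, real_inner_smul_right, real_inner_smul_right,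
      inner_add_right, hb, real_inner_comm f a, Real.norm_of_nonneg (by norm_num)]
    ring
  rw [hP, h1, doubleDot_axial hv hS, h3 _ _ h2]

/-! ### The Fourier side -/

/-- `(v · ξ)² / |ξ|²`. -/
def cosSq (v ξ : E3) : ℝ := inner ℝ v ξ ^ 2 / ‖ξ‖ ^ 2

lemma cosSq_nonneg (v ξ : E3) : 0 ≤ cosSq v ξ := by
  unfold cosSq
  positivity

lemma cosSq_le_one {v : E3} (hv : ‖v‖ = 1) (ξ : E3) : cosSq v ξ ≤ 1 := by
  refine div_le_one_of_le₀ ?_ (by positivity)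
  rw [sq_le_sq, abs_norm]
  simpa [hv] using abs_real_inner_le_norm v ξ

lemma fourierReal_add (f g : L2) : fourierReal (f + g) = fourierReal f + fourierReal g := by
  rw [fourierReal, map_add]
  exact (Lp.fourierTransformₗᵢ E3 ℂ).map_add _ _

lemma fourierReal_smul (c : ℝ) (f : L2) : fourierReal (c • f) = (c : ℂ) • fourierReal f := by
  rw [fourierReal, map_smul, RCLike.real_smul_eq_coe_smul (K := ℂ)]
  exact (Lp.fourierTransformₗᵢ E3 ℂ).map_smul _ _

lemma coeFn_fourierReal_smul (c : ℝ) (f : L2) :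
    fourierReal (c • f) =ᵐ[volume] fun ξ => (c : ℂ) * fourierReal f ξ := by
  rw [fourierReal_smul]
  exact Lp.coeFn_smul _ _

lemma coeFn_fourierReal_dirRiesz (v : E3) (f : L2) : fourierReal (dirRiesz v f) =ᵐ[volume]
    fun ξ => Complex.I * ((inner ℝ v ξ / ‖ξ‖ : ℝ) : ℂ) * fourierReal f ξ := by
  have h : dirRiesz v f = v 0 • riesz 0 f + v 1 • riesz 1 f + v 2 • riesz 2 f := by
    rw [dirRiesz_apply, Fin.sum_univ_three]
  rw [h, fourierReal_add, fourierReal_add]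
  filter_upwards [Lp.coeFn_add (fourierReal (v 0 • riesz 0 f) + fourierReal (v 1 • riesz 1 f))
      (fourierReal (v 2 • riesz 2 f)),
    Lp.coeFn_add (fourierReal (v 0 • riesz 0 f)) (fourierReal (v 1 • riesz 1 f)),
    coeFn_fourierReal_smul (v 0) (riesz 0 f), coeFn_fourierReal_smul (v 1) (riesz 1 f),
    coeFn_fourierReal_smul (v 2) (riesz 2 f), coeFn_fourierReal_riesz 0 f,
    coeFn_fourierReal_riesz 1 f, coeFn_fourierReal_riesz 2 f] with ξ h1 h2 h3 h4 h5 h6 h7 h8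
  rw [h1, Pi.add_apply, h2, Pi.add_apply, h3, h4, h5, h6, h7, h8]
  simp only [rieszSymbol, PiLp.inner_apply, Fin.sum_univ_three, RCLike.inner_apply, conj_trivial]
  push_cast
  ring

lemma coeFn_fourierReal_dirRiesz_sq (v : E3) (f : L2) :
    fourierReal (dirRiesz v (dirRiesz v f) + (1 / 2 : ℝ) • f) =ᵐ[volume]
      fun ξ => ((1 / 2 - cosSq v ξ : ℝ) : ℂ) * fourierReal f ξ := by
  rw [fourierReal_add]
  filter_upwards [Lp.coeFn_add (fourierReal (dirRiesz v (dirRiesz v f)))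
      (fourierReal ((1 / 2 : ℝ) • f)), coeFn_fourierReal_smul (1 / 2) f,
    coeFn_fourierReal_dirRiesz v (dirRiesz v f), coeFn_fourierReal_dirRiesz v f]
    with ξ h1 h2 h3 h4
  rw [h1, Pi.add_apply, h2, h3, h4, cosSq]
  push_cast
  linear_combination (inner ℝ v ξ / ‖ξ‖ : ℂ) ^ 2 * fourierReal f ξ * Complex.I_sq

/-- T² + 1/2 has symbol 1/2 - cos²θ, which is at most ε/2 in absolute value on the region. -/
lemma norm_dirRiesz_sq_le_of_cone {v : E3} {ε : ℝ} {f : L2}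
    (hf : ∀ᵐ ξ : E3, ξ ∉ coneRegion v ε → fourierReal f ξ = 0) :
    ‖dirRiesz v (dirRiesz v f) + (1 / 2 : ℝ) • f‖ ≤ ε / 2 * ‖f‖ := by
  rw [← norm_fourierReal, ← norm_fourierReal f]
  refine Lp.norm_le_mul_norm_of_ae_le_mul ?_
  filter_upwards [hf, coeFn_fourierReal_dirRiesz_sq v f] with ξ h1 h2
  rw [h2, norm_mul, Complex.norm_real, Real.norm_eq_abs]
  by_cases hξ : ξ ∈ coneRegion v ε
  · refine mul_le_mul_of_nonneg_right ?_ (norm_nonneg _)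
    obtain ⟨h3, h4⟩ := hξ
    rw [abs_le, cosSq]
    constructor <;> linarith
  · simp [h1 hξ]

lemma norm_sq_eq_integral (g : L2C) : ‖g‖ ^ 2 = ∫ x, ‖g x‖ ^ 2 := by
  have h : inner ℂ g g = ((∫ x, ‖g x‖ ^ 2 : ℝ) : ℂ) := by
    rw [L2.inner_def, ← integral_complex_ofReal]
    refine integral_congr_ae (Eventually.of_forall fun x => ?_)
    simp only [inner_self_eq_norm_sq_to_K]
    norm_cast
  rw [← inner_self_eq_norm_sq (𝕜 := ℂ) g, h]
  rfl

/-! ### Gaussians -/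

/-- Change of variables by an invertible linear map. -/
lemma exists_integral_comp_linearMap {N : E3 →ₗ[ℝ] E3} (hN : LinearMap.det N ≠ 0) :
    ∃ κ : ℝ, 0 < κ ∧ ∀ {F : Type} [NormedAddCommGroup F] [NormedSpace ℝ F] (f : E3 → F),
      ∫ x, f (N x) = κ • ∫ x, f x := by
  refine ⟨|(LinearMap.det N)⁻¹|, by positivity, fun f => ?_⟩
  have hemb : MeasurableEmbedding N :=
    (LinearEquiv.ofIsUnitDet (v := Module.finBasis ℝ E3) (v' := Module.finBasis ℝ E3) (f := N)
      (by rw [LinearMap.det_toMatrix]; exact hN.isUnit)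
      ).toContinuousLinearEquiv.toHomeomorph.measurableEmbedding
  rw [← hemb.integral_map, Measure.map_linearMap_addHaar_eq_smul_addHaar volume hN,
    integral_smul_measure, ENNReal.toReal_ofReal (abs_nonneg _)]

lemma integrable_comp_linearMap {N : E3 →ₗ[ℝ] E3} (hN : LinearMap.det N ≠ 0) {f : E3 → ℝ}
    (hf : Integrable f) : Integrable (fun x => f (N x)) := by
  have hmeas : Measurable N := (LinearMap.continuous_of_finiteDimensional N).measurable
  have h : Integrable f (Measure.map N volume) := by
    rw [Measure.map_linearMap_addHaar_eq_smul_addHaar volume hN]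
    exact hf.smul_measure ENNReal.ofReal_ne_top
  exact h.comp_measurable hmeas

lemma integrable_exp_neg_mul_sq_norm {c : ℝ} (hc : 0 < c) :
    Integrable (fun x : E3 => Real.exp (-c * ‖x‖ ^ 2)) := by
  have h := (GaussianFourier.integrable_cexp_neg_mul_sq_norm_add (V := E3) (b := (c : ℂ))
    (by simpa using hc) 0 0).norm
  refine h.congr (Eventually.of_forall fun x => ?_)
  simp only [zero_mul, add_zero, Complex.norm_exp]
  norm_cast

/-- The Fourier transform of `exp (-π² |N x|²)` is a multiple of `exp (-|D ξ|²)`, where `D` is the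
inverse transpose of `N`. -/
lemma exists_fourier_gaussian_comp {N D : E3 →ₗ[ℝ] E3} (hN : LinearMap.det N ≠ 0)
    (hND : ∀ x ξ, inner ℝ (N x) (D ξ) = inner ℝ x ξ) :
    ∃ c : ℝ, 0 < c ∧ ∀ ξ, 𝓕 (fun x : E3 => ((Real.exp (-Real.pi ^ 2 * ‖N x‖ ^ 2) : ℝ) : ℂ)) ξ =
      ((c * Real.exp (-‖D ξ‖ ^ 2) : ℝ) : ℂ) := by
  obtain ⟨κ, hκ, h⟩ := exists_integral_comp_linearMap hN
  refine ⟨κ * (Real.pi / Real.pi ^ 2) ^ ((3 : ℝ) / 2), by positivity, fun ξ => ?_⟩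
  have hπ : (Real.pi : ℂ) ≠ 0 := by exact_mod_cast Real.pi_ne_zero
  -- The parameter π² is the one for which the transform has exponent exactly -|·|².
  have h1 := fourier_gaussian_innerProductSpace (V := E3) (b := ((Real.pi ^ 2 : ℝ) : ℂ))
    (by rw [Complex.ofReal_re]; positivity) (D ξ)
  rw [Real.fourier_eq] at h1 ⊢
  have h2 := h (fun y : E3 => 𝐞 (-inner ℝ y (D ξ)) • Complex.exp (-((Real.pi ^ 2 : ℝ) : ℂ) *
    (‖y‖ : ℂ) ^ 2))
  rw [h1] at h2
  simp only [hND] at h2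
  have h3 : (((Real.pi / Real.pi ^ 2) ^ ((3 : ℝ) / 2) : ℝ) : ℂ) =
      ((Real.pi : ℂ) / ((Real.pi ^ 2 : ℝ) : ℂ)) ^ (((Module.finrank ℝ E3 : ℕ) : ℂ) / 2) := by
    rw [Complex.ofReal_cpow (by positivity)]
    simp
  have h4 : -(Real.pi : ℂ) ^ 2 * (‖D ξ‖ : ℂ) ^ 2 / ((Real.pi ^ 2 : ℝ) : ℂ) =
      ((-‖D ξ‖ ^ 2 : ℝ) : ℂ) := by
    push_cast
    field_simp
  rw [← h3, h4] at h2
  calc _ = _ := by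
        congr 1
        ext x
        push_cast
        rfl
    _ = _ := h2
    _ = _ := by
        rw [Complex.real_smul]
        push_cast
        ring

/-- Normalised positive Gaussians, with the Rayleigh quotient of `(T² + 1/2)²` after the change of
variables that makes the weight isotropic. -/
lemma exists_gaussian {v : E3} {N D : E3 →ₗ[ℝ] E3} (hN : LinearMap.det N ≠ 0)
    (hND : ∀ x ξ, inner ℝ (N x) (D ξ) = inner ℝ x ξ) (hDN : ∀ x, D (N x) = x) :
    ∃ (a : ℝ) (lam : L2), 0 < a ∧ ‖lam‖ = 1 ∧ (∀ᵐ x : E3, 0 < lam x) ∧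
      (∀ᵐ ξ : E3, fourierReal lam ξ = ((a * Real.exp (-‖D ξ‖ ^ 2) : ℝ) : ℂ)) ∧
      ‖dirRiesz v (dirRiesz v lam) + (1 / 2 : ℝ) • lam‖ ^ 2 * ∫ z : E3, Real.exp (-‖z‖ ^ 2) ^ 2 =
        ∫ z : E3, (1 / 2 - cosSq v (N z)) ^ 2 * Real.exp (-‖z‖ ^ 2) ^ 2 := by
  set p : E3 → ℝ := fun x => Real.exp (-Real.pi ^ 2 * ‖N x‖ ^ 2) with hp
  have hpos : ∀ x, 0 < p x := fun x => Real.exp_pos _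
  have hcont : Continuous p := by
    have := LinearMap.continuous_of_finiteDimensional N
    fun_prop
  have hint : Integrable p := by
    have := integrable_comp_linearMap hN
      (integrable_exp_neg_mul_sq_norm (c := Real.pi ^ 2) (by positivity))
    exact this
  have hint2 : Integrable (fun x => p x ^ 2) := by
    have := integrable_comp_linearMap hN
      (integrable_exp_neg_mul_sq_norm (c := 2 * Real.pi ^ 2) (by positivity))
    refine this.congr (Eventually.of_forall fun x => ?_)
    simp only [hp, ← Real.exp_nat_mul]
    congr 1
    push_cast
    ring
  have hmem : MemLp p 2 := (memLp_two_iff_integrable_sq hcont.aestronglyMeasurable).mpr hint2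
  have hmemC : MemLp (fun x => (p x : ℂ)) 2 := hmem.ofReal
  set P : L2 := hmem.toLp p with hP
  have hPC : toComplex P = hmemC.toLp _ := by
    apply Lp.ext
    filter_upwards [coeFn_toComplex P, hmem.coeFn_toLp, hmemC.coeFn_toLp] with x h1 h2 h3
    rw [h1, h2, h3]
  have hP0 : 0 < ‖P‖ := by
    rw [norm_pos_iff]
    intro h0
    have h1 : p =ᵐ[volume] 0 := (Lp.coeFn_zero ℝ 2 (volume : Measure E3)) |> fun h => by
      filter_upwards [h, hmem.coeFn_toLp] with x h1 h2
      rw [← h2, ← hP, h0, h1]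
    obtain ⟨x, hx⟩ := h1.exists
    exact (hpos x).ne' hx
  obtain ⟨c, hc, hF⟩ := exists_fourier_gaussian_comp hN hND
  have hlam : ∀ᵐ ξ : E3, fourierReal (‖P‖⁻¹ • P) ξ =
      ((‖P‖⁻¹ * c * Real.exp (-‖D ξ‖ ^ 2) : ℝ) : ℂ) := by
    filter_upwards [coeFn_fourierReal_smul ‖P‖⁻¹ P,
      fourier_toLp_ae_eq (hint.ofReal (𝕜 := ℂ)) hmemC] with ξ h1 h2
    rw [h1, fourierReal, hPC]
    refine (congrArg (fun z => ((‖P‖⁻¹ : ℝ) : ℂ) * z) (h2.trans (hF ξ))).trans ?_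
    push_cast
    ring
  set lam : L2 := ‖P‖⁻¹ • P
  have hnorm : ‖lam‖ = 1 := by
    rw [norm_smul, norm_inv, norm_norm, inv_mul_cancel₀ hP0.ne']
  refine ⟨‖P‖⁻¹ * c, lam, by positivity, hnorm, ?_, hlam, ?_⟩
  · filter_upwards [Lp.coeFn_smul ‖P‖⁻¹ P, hmem.coeFn_toLp] with x h1 h2
    rw [h1, Pi.smul_apply, h2, smul_eq_mul]
    exact mul_pos (inv_pos.mpr hP0) (hpos x)
  -- Plancherel writes both ‖lam‖² = 1 and the loss as integrals against the same Gaussian weight.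
  -- Substituting ξ = N z makes the weight isotropic, and the Jacobian κ and a² cancel in the
  -- quotient.
  · obtain ⟨κ, hκ, hch⟩ := exists_integral_comp_linearMap hN
    set a := ‖P‖⁻¹ * c
    have e1 : ∫ ξ : E3, (a * Real.exp (-‖D ξ‖ ^ 2)) ^ 2 = 1 := by
      rw [← one_pow 2, ← hnorm, ← norm_fourierReal, norm_sq_eq_integral]
      refine integral_congr_ae ?_
      filter_upwards [hlam] with ξ h
      rw [h, Complex.norm_real, Real.norm_eq_abs, sq_abs]
    have e2 : ‖dirRiesz v (dirRiesz v lam) + (1 / 2 : ℝ) • lam‖ ^ 2 =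
        ∫ ξ : E3, (1 / 2 - cosSq v ξ) ^ 2 * (a * Real.exp (-‖D ξ‖ ^ 2)) ^ 2 := by
      rw [← norm_fourierReal, norm_sq_eq_integral]
      refine integral_congr_ae ?_
      filter_upwards [hlam, coeFn_fourierReal_dirRiesz_sq v lam] with ξ h h'
      rw [h', h, norm_mul, Complex.norm_real, Complex.norm_real, Real.norm_eq_abs,
        Real.norm_eq_abs, mul_pow, sq_abs, sq_abs]
    have e3 := hch (fun ξ : E3 => (a * Real.exp (-‖D ξ‖ ^ 2)) ^ 2)
    have e4 := hch (fun ξ : E3 => (1 / 2 - cosSq v ξ) ^ 2 * (a * Real.exp (-‖D ξ‖ ^ 2)) ^ 2)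
    rw [e1] at e3
    rw [← e2] at e4
    simp only [hDN, mul_pow, smul_eq_mul, mul_one, mul_left_comm _ (a ^ 2), integral_const_mul]
      at e3 e4
    have ha : a ^ 2 ≠ 0 := by positivity
    refine mul_left_cancel₀ ha ?_
    rw [e4, ← e3]
    ring

/-! ### Concentrating Gaussians -/

/-- The linear map that is diagonal in the basis `b`, with eigenvalues `m`. -/
def diagMap (b : OrthonormalBasis (Fin 3) ℝ E3) (m : Fin 3 → ℝ) : E3 →ₗ[ℝ] E3 where
  toFun x := ∑ i, (m i * inner ℝ (b i) x) • b i
  map_add' x y := by simp only [inner_add_right, mul_add, add_smul, Finset.sum_add_distrib]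
  map_smul' c x := by
    simp only [inner_smul_right, RingHom.id_apply, Finset.smul_sum, smul_smul, mul_left_comm]

lemma inner_diagMap (b : OrthonormalBasis (Fin 3) ℝ E3) (m : Fin 3 → ℝ) (j : Fin 3) (x : E3) :
    inner ℝ (b j) (diagMap b m x) = m j * inner ℝ (b j) x := by
  simp only [diagMap, LinearMap.coe_mk, AddHom.coe_mk]
  exact b.orthonormal.inner_right_fintype _ j

lemma inner_eq_sum (b : OrthonormalBasis (Fin 3) ℝ E3) (x y : E3) :
    inner ℝ x y = ∑ i, inner ℝ (b i) x * inner ℝ (b i) y := by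
  rw [← b.sum_inner_mul_inner]
  simp only [real_inner_comm]

lemma norm_sq_eq_sum (b : OrthonormalBasis (Fin 3) ℝ E3) (x : E3) :
    ‖x‖ ^ 2 = ∑ i, inner ℝ (b i) x ^ 2 := by
  rw [← real_inner_self_eq_norm_sq, inner_eq_sum b]
  simp only [sq]

lemma diagMap_diagMap (b : OrthonormalBasis (Fin 3) ℝ E3) {m k : Fin 3 → ℝ}
    (h : ∀ i, m i * k i = 1) (x : E3) : diagMap b m (diagMap b k x) = x := by
  refine b.repr.injective (PiLp.ext fun i => ?_)
  rw [b.repr_apply_apply, b.repr_apply_apply, inner_diagMap, inner_diagMap, ← mul_assoc, h, one_mul]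

lemma inner_diagMap_diagMap (b : OrthonormalBasis (Fin 3) ℝ E3) {m k : Fin 3 → ℝ}
    (h : ∀ i, m i * k i = 1) (x y : E3) : inner ℝ (diagMap b m x) (diagMap b k y) = inner ℝ x y := by
  rw [inner_eq_sum b, inner_eq_sum b x y]
  refine Finset.sum_congr rfl fun i _ => ?_
  rw [inner_diagMap, inner_diagMap]
  linear_combination (inner ℝ (b i) x * inner ℝ (b i) y) * h i

lemma det_diagMap_ne_zero (b : OrthonormalBasis (Fin 3) ℝ E3) {m k : Fin 3 → ℝ}
    (h : ∀ i, m i * k i = 1) : LinearMap.det (diagMap b m) ≠ 0 := by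
  have : (diagMap b m).comp (diagMap b k) = LinearMap.id :=
    LinearMap.ext fun x => diagMap_diagMap b h x
  have h2 := congrArg LinearMap.det this
  rw [LinearMap.det_comp, LinearMap.det_id] at h2
  exact left_ne_zero_of_mul_eq_one h2

/-- The scalings `(1/√n, 1/√n, √n)`, which stretch along the last basis vector. -/
def scaling (n : ℕ) : Fin 3 → ℝ := ![(√n)⁻¹, (√n)⁻¹, √n]

lemma scaling_mul_inv {n : ℕ} (hn : 1 ≤ n) (i : Fin 3) : scaling n i * (scaling n i)⁻¹ = 1 := by
  have : 0 < √(n : ℝ) := Real.sqrt_pos.mpr (by exact_mod_cast hn)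
  refine mul_inv_cancel₀ ?_
  fin_cases i <;> simp [scaling] <;> omega

lemma exp_neg_norm_diagMap (b : OrthonormalBasis (Fin 3) ℝ E3) (n : ℕ) (ξ : E3) :
    Real.exp (-‖diagMap b (fun i => (scaling n i)⁻¹) ξ‖ ^ 2) = gaussianProfile b n ξ := by
  rw [norm_sq_eq_sum b, gaussianProfile]
  congr 1
  simp only [inner_diagMap, Fin.sum_univ_three, mul_pow, scaling, Matrix.cons_val_zero, Matrix.cons_val_one, Matrix.cons_val, inv_inv,
    inv_pow, Real.sq_sqrt (Nat.cast_nonneg n)]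
  ring

lemma ae_inner_ne_zero {w : E3} (hw : w ≠ 0) : ∀ᵐ z : E3, inner ℝ w z ≠ 0 := by
  have h := Measure.addHaar_submodule (volume : Measure E3) (ℝ ∙ w)ᗮ fun htop => hw (by
    have : w ∈ (ℝ ∙ w)ᗮ := htop ▸ Submodule.mem_top
    exact inner_self_eq_zero.mp (Submodule.mem_orthogonal_singleton_iff_inner_right.mp this))
  rw [ae_iff]
  refine measure_mono_null (fun z hz => ?_) h
  exact Submodule.mem_orthogonal_singleton_iff_inner_right.mpr (not_not.mp hz)

/-- The stretched vector turns towards the line spanned by `b 2` as soon as z has a component along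
it. Factoring √n out of the inner product and the norm leaves a rational function of 1/n. -/
lemma tendsto_cosSq_diagMap (b : OrthonormalBasis (Fin 3) ℝ E3) {v z : E3}
    (hz : inner ℝ (b 2) z ≠ 0) :
    Tendsto (fun n : ℕ => cosSq v (diagMap b (scaling n) z)) atTop (𝓝 (inner ℝ v (b 2) ^ 2)) := by
  set z0 := inner ℝ (b 0) z
  set z1 := inner ℝ (b 1) z
  set z2 := inner ℝ (b 2) z
  set v0 := inner ℝ (b 0) v
  set v1 := inner ℝ (b 1) v
  set v2 := inner ℝ (b 2) v with hv2
  have hlim : Tendsto (fun n : ℕ => ((v0 * z0 + v1 * z1) * (n : ℝ)⁻¹ + v2 * z2) ^ 2 /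
      ((z0 ^ 2 + z1 ^ 2) * (n : ℝ)⁻¹ ^ 2 + z2 ^ 2)) atTop
      (𝓝 (((v0 * z0 + v1 * z1) * 0 + v2 * z2) ^ 2 /
      ((z0 ^ 2 + z1 ^ 2) * 0 ^ 2 + z2 ^ 2))) := by
    have h : Tendsto (fun n : ℕ => (n : ℝ)⁻¹) atTop (𝓝 0) := tendsto_inv_atTop_nhds_zero_nat
    refine Tendsto.div ?_ ?_ (by simpa using hz)
    · exact ((h.const_mul _).add_const _).pow 2
    · exact ((h.pow 2).const_mul _).add_const _
  have hval : ((v0 * z0 + v1 * z1) * 0 + v2 * z2) ^ 2 / ((z0 ^ 2 + z1 ^ 2) * 0 ^ 2 + z2 ^ 2) =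
      inner ℝ v (b 2) ^ 2 := by
    rw [real_inner_comm, ← hv2]
    field_simp
    ring
  rw [hval] at hlim
  refine hlim.congr' ?_
  filter_upwards [eventually_ge_atTop 1] with n hn
  have hn' : (0 : ℝ) < n := by exact_mod_cast hn
  have hs : 0 < √(n : ℝ) := Real.sqrt_pos.mpr hn'
  have hsq : √(n : ℝ) ^ 2 = n := Real.sq_sqrt hn'.le
  rw [cosSq, inner_eq_sum b v, norm_sq_eq_sum b]
  simp only [inner_diagMap, Fin.sum_univ_three, scaling, Matrix.cons_val_zero,
    Matrix.cons_val_one, Matrix.cons_val]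
  set s := √(n : ℝ)
  have e1 : v0 * (s⁻¹ * z0) + v1 * (s⁻¹ * z1) + v2 * (s * z2) =
      s * ((v0 * z0 + v1 * z1) * (n : ℝ)⁻¹ + v2 * z2) := by
    rw [← hsq]
    field_simp
  have e2 : (s⁻¹ * z0) ^ 2 + (s⁻¹ * z1) ^ 2 + (s * z2) ^ 2 =
      s ^ 2 * ((z0 ^ 2 + z1 ^ 2) * (n : ℝ)⁻¹ ^ 2 + z2 ^ 2) := by
    rw [← hsq]
    field_simp
  change _ = (v0 * (s⁻¹ * z0) + v1 * (s⁻¹ * z1) + v2 * (s * z2)) ^ 2 /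
    ((s⁻¹ * z0) ^ 2 + (s⁻¹ * z1) ^ 2 + (s * z2) ^ 2)
  rw [e1, e2, mul_pow, mul_div_mul_left _ _ (by positivity)]

lemma integrable_exp_neg_sq_norm_sq :
    Integrable (fun z : E3 => Real.exp (-‖z‖ ^ 2) ^ 2) := by
  refine (integrable_exp_neg_mul_sq_norm (c := 2) two_pos).congr
    (Eventually.of_forall fun z => ?_)
  simp only [← Real.exp_nat_mul]
  congr 1
  push_cast
  ring

/-- Dominated convergence: the squared factor is at most 1 since cos²θ lies in [0, 1], and it tends
to 0 off the null hyperplane orthogonal to `b 2`. -/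
lemma tendsto_integral_cosSq {v : E3} (hv : ‖v‖ = 1) (b : OrthonormalBasis (Fin 3) ℝ E3)
    (hb : inner ℝ v (b 2) ^ 2 = 1 / 2) :
    Tendsto (fun n : ℕ => ∫ z : E3, (1 / 2 - cosSq v (diagMap b (scaling n) z)) ^ 2 *
      Real.exp (-‖z‖ ^ 2) ^ 2) atTop (𝓝 0) := by
  have h := tendsto_integral_of_dominated_convergence (μ := (volume : Measure E3))
    (F := fun (n : ℕ) z => (1 / 2 - cosSq v (diagMap b (scaling n) z)) ^ 2 *
      Real.exp (-‖z‖ ^ 2) ^ 2) (f := fun _ => 0) (fun z : E3 => Real.exp (-‖z‖ ^ 2) ^ 2)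
    (fun n => ?_) integrable_exp_neg_sq_norm_sq
    (fun n => Eventually.of_forall fun z => ?_) ?_
  · simpa using h
  · have hm : Measurable (diagMap b (scaling n)) :=
      (LinearMap.continuous_of_finiteDimensional _).measurable
    have hc : Measurable (cosSq v) := by
      unfold cosSq
      fun_prop
    have := hc.comp hm
    simp only [Function.comp_def] at this
    exact Measurable.aestronglyMeasurable (by fun_prop)
  · rw [Real.norm_of_nonneg (by positivity)]
    have h0 := cosSq_nonneg v (diagMap b (scaling n) z)
    have h1 := cosSq_le_one hv (diagMap b (scaling n) z)
    refine mul_le_of_le_one_left (by positivity) ?_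
    nlinarith
  · filter_upwards [ae_inner_ne_zero (b.toBasis.ne_zero 2)] with z hz
    rw [OrthonormalBasis.coe_toBasis] at hz
    have h := (((tendsto_cosSq_diagMap b (v := v) hz).const_sub (1 / 2)).pow 2).mul_const
      (Real.exp (-‖z‖ ^ 2) ^ 2)
    simpa [hb] using h

/-! ### The projection of `(λ / √6) (I₃ - 3 v ⊗ v)` -/

lemma norm_smul_field (c : ℝ) (S : L2sym) : ‖c • S‖ = |c| * ‖S‖ :=
  @norm_smul ℝ L2sym _ _ _ NormedSpace.toNormSMulClass c S

/-- The case c = 3, where 2c²/6 = 3. -/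
lemma norm_sq_Pst_compression {v : E3} (hv : ‖v‖ = 1) (f : L2) :
    ‖Pst (compression v f)‖ ^ 2 = 3 / 4 * ‖f‖ ^ 2 -
      3 * ‖dirRiesz v (dirRiesz v f) + (1 / 2 : ℝ) • f‖ ^ 2 := by
  rw [compression, map_smul, norm_smul_field, mul_pow, norm_sq_Pst_axialField hv, sq_abs, inv_pow, Real.sq_sqrt (by norm_num)]
  ring

lemma exists_gaussian_sequence {v : E3} (hv : ‖v‖ = 1) (b : OrthonormalBasis (Fin 3) ℝ E3)
    (hb : inner ℝ v (b 2) ^ 2 = 1 / 2) :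
    ∃ (a : ℕ → ℝ) (lam : ℕ → L2),
      (∀ n, 1 ≤ n → 0 < a n ∧ ‖lam n‖ = 1 ∧ (∀ᵐ x : E3, 0 < lam n x) ∧
        ∀ᵐ ξ : E3, fourierReal (lam n) ξ = ((a n * gaussianProfile b n ξ : ℝ) : ℂ)) ∧
      Tendsto (fun n => ‖Pst (compression v (lam n))‖ ^ 2) atTop (𝓝 (3 / 4)) := by
  set J := ∫ z : E3, Real.exp (-‖z‖ ^ 2) ^ 2 with hJdef
  have hJ : 0 < J := by
    rw [hJdef, integral_pos_iff_support_of_nonneg (fun z => by positivity)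
      integrable_exp_neg_sq_norm_sq]
    have : Function.support (fun z : E3 => Real.exp (-‖z‖ ^ 2) ^ 2) = Set.univ :=
      Set.eq_univ_of_forall fun z => (pow_pos (Real.exp_pos _) 2).ne'
    rw [this]
    exact Measure.measure_univ_pos.mpr (NeZero.ne _)
  have hex : ∀ n : ℕ, ∃ (a : ℝ) (lam : L2), 1 ≤ n → (0 < a ∧ ‖lam‖ = 1 ∧ (∀ᵐ x : E3, 0 < lam x) ∧
      (∀ᵐ ξ : E3, fourierReal lam ξ = ((a * gaussianProfile b n ξ : ℝ) : ℂ)) ∧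
      ‖dirRiesz v (dirRiesz v lam) + (1 / 2 : ℝ) • lam‖ ^ 2 * J =
        ∫ z : E3, (1 / 2 - cosSq v (diagMap b (scaling n) z)) ^ 2 * Real.exp (-‖z‖ ^ 2) ^ 2) := by
    intro n
    by_cases hn : 1 ≤ n
    · have hinv : ∀ i, (scaling n i)⁻¹ * scaling n i = 1 := fun i => by
        rw [mul_comm, scaling_mul_inv hn]
      obtain ⟨a, lam, h1, h2, h3, h4, h5⟩ := exists_gaussian (v := v)
        (det_diagMap_ne_zero b (scaling_mul_inv hn))
        (inner_diagMap_diagMap b (scaling_mul_inv hn)) (diagMap_diagMap b hinv)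
      simp only [exp_neg_norm_diagMap] at h4
      exact ⟨a, lam, fun _ => ⟨h1, h2, h3, h4, h5⟩⟩
    -- At n = 0 the scaling is degenerate, and nothing is claimed there.
    · exact ⟨0, 0, fun h => absurd h hn⟩
  choose a lam h using hex
  refine ⟨a, lam, fun n hn => ?_, ?_⟩
  · obtain ⟨h1, h2, h3, h4, -⟩ := h n hn
    exact ⟨h1, h2, h3, h4⟩
  · have hlim := (((tendsto_integral_cosSq hv b hb).div_const J).const_mul 3).const_sub (3 / 4)
    rw [zero_div, mul_zero, sub_zero] at hlim
    refine hlim.congr' ?_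
    filter_upwards [eventually_ge_atTop 1] with n hn
    obtain ⟨-, h2, -, -, h5⟩ := h n hn
    rw [norm_sq_Pst_compression hv, h2, ← h5, mul_div_cancel_right₀ _ hJ.ne']
    ring

lemma exists_orthonormalBasis_inner_sq {v : E3} (hv : ‖v‖ = 1) :
    ∃ b : OrthonormalBasis (Fin 3) ℝ E3, inner ℝ v (b 2) ^ 2 = 1 / 2 := by
  have hext : ∀ (w : E3) (i : Fin 3), ‖w‖ = 1 →
      ∃ b : OrthonormalBasis (Fin 3) ℝ E3, b i = w := by
    intro w i hw
    have hon : Orthonormal ℝ (({i} : Set (Fin 3)).domRestrict fun _ => w) :=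
      ⟨fun _ => hw, fun j k hjk => (hjk (Subsingleton.elim j k)).elim⟩
    obtain ⟨b, hb⟩ := hon.exists_orthonormalBasis_extension_of_card_eq (by simp)
    exact ⟨b, hb i rfl⟩
  obtain ⟨b', hb'⟩ := hext v 0 hv
  have h01 : inner ℝ v (b' 1) = 0 := by
    rw [← hb']
    exact b'.orthonormal.2 (by decide)
  have hsq : ‖v + b' 1‖ ^ 2 = 2 := by
    rw [norm_add_sq_real, h01, hv, b'.orthonormal.1 1]
    norm_num
  have h2 : (√2)⁻¹ ^ 2 = (1 / 2 : ℝ) := by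
    rw [inv_pow, Real.sq_sqrt (by norm_num)]
    norm_num
  -- The bisector of v and a unit vector orthogonal to it makes an angle of 45° with v.
  obtain ⟨b, hb⟩ := hext ((√2)⁻¹ • (v + b' 1)) 2 (by
    rw [← sq_eq_sq₀ (norm_nonneg _) zero_le_one, norm_smul, mul_pow, hsq, Real.norm_eq_abs,
      sq_abs, h2]
    norm_num)
  refine ⟨b, ?_⟩
  rw [hb, inner_smul_right, inner_add_right, h01, real_inner_self_eq_norm_sq, hv, mul_pow, h2]
  norm_num

/-! ### Single diagonal components of strains -/

lemma norm_sq_Pst_axialField_le {v : E3} (hv : ‖v‖ = 1) (c : ℝ) (f : L2) :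
    ‖Pst (axialField c v f)‖ ^ 2 ≤ c ^ 2 / 2 * ‖f‖ ^ 2 := by
  rw [norm_sq_Pst_axialField hv]
  nlinarith [mul_nonneg (sq_nonneg c)
    (sq_nonneg ‖dirRiesz v (dirRiesz v f) + (1 / 2 : ℝ) • f‖)]

lemma inner_doubleDot {S : L2sym} (hS : S ∈ strain) (v : E3) (f : L2) :
    inner ℝ (Pst (axialField 1 v f)) S = -inner ℝ f (doubleDot v S) := by
  rw [inner_Pst hS, inner_axialField_of_mem_strain hS]
  ring

/-- Duality: test S against the projection of f (I₃ - v ⊗ v) with f = S : (v ⊗ v) itself.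
Cauchy–Schwarz and the projection bound for c = 1 then leave one factor ‖f‖² to cancel. -/
lemma norm_sq_doubleDot_le {v : E3} (hv : ‖v‖ = 1) {S : L2sym} (hS : S ∈ strain) :
    ‖doubleDot v S‖ ^ 2 ≤ 1 / 2 * ‖S‖ ^ 2 := by
  set f := doubleDot v S with hf
  set F := Pst (axialField 1 v f)
  have h1 : ‖f‖ ^ 2 ≤ ‖F‖ * ‖S‖ := by
    have h := inner_doubleDot hS v f
    rw [← hf, real_inner_self_eq_norm_sq] at h
    have h2 : |inner ℝ F S| ≤ ‖F‖ * ‖S‖ := abs_real_inner_le_norm F S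
    rw [h, abs_neg, abs_of_nonneg (sq_nonneg _)] at h2
    exact h2
  have h2 : ‖F‖ ^ 2 ≤ 1 / 2 * ‖f‖ ^ 2 := by simpa using norm_sq_Pst_axialField_le hv 1 f
  rcases (norm_nonneg f).eq_or_lt with h0 | h0
  · rw [← h0]
    linarith [sq_nonneg ‖S‖]
  · have h3 : (‖f‖ ^ 2) ^ 2 ≤ ‖F‖ ^ 2 * ‖S‖ ^ 2 := by
      rw [← mul_pow]
      exact pow_le_pow_left₀ (by positivity) h1 2
    have h4 : ‖f‖ ^ 2 * ‖f‖ ^ 2 ≤ ‖f‖ ^ 2 * (1 / 2 * ‖S‖ ^ 2) := by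
      nlinarith [mul_le_mul_of_nonneg_right h2 (sq_nonneg ‖S‖)]
    exact le_of_mul_le_mul_left h4 (by positivity)

lemma doubleDot_smul (v : E3) (c : ℝ) (S : L2sym) : doubleDot v (c • S) = c • doubleDot v S := by
  simp only [doubleDot_apply, map_smul, Finset.smul_sum, smul_comm c]

/-- The normalised projection of an axial field is a test strain for the diagonal component. -/
lemma exists_strain_doubleDot_ge {v : E3} {f : L2} (hf : ‖f‖ = 1)
    (hpos : 0 < ‖Pst (axialField 1 v f)‖) :
    ∃ S ∈ strain, ‖S‖ = 1 ∧ ‖Pst (axialField 1 v f)‖ ^ 2 ≤ ‖doubleDot v S‖ ^ 2 := by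
  set F := Pst (axialField 1 v f) with hF
  have hmem : F ∈ strain := Pst_mem_strain _
  refine ⟨‖F‖⁻¹ • F, strain.smul_mem _ hmem, ?_, ?_⟩
  · rw [norm_smul_field, abs_inv, abs_of_pos hpos, inv_mul_cancel₀ hpos.ne']
  · have h := inner_doubleDot hmem v f
    have h1 : ‖F‖ ^ 2 ≤ ‖doubleDot v F‖ := by
      have h2 : ‖F‖ ^ 2 = inner ℝ F F := (real_inner_self_eq_norm_sq F).symm
      have h3 := abs_real_inner_le_norm f (doubleDot v F)
      rw [hf, one_mul] at h3
      rw [h2, h]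
      exact (neg_le_abs _).trans h3
    refine pow_le_pow_left₀ hpos.le ?_ 2
    rw [doubleDot_smul, norm_smul, Real.norm_eq_abs, abs_inv, abs_of_pos hpos]
    calc ‖F‖ = ‖F‖⁻¹ * ‖F‖ ^ 2 := by field_simp
      _ ≤ _ := mul_le_mul_of_nonneg_left h1 (by positivity)

lemma norm_sq_axialField_three {v : E3} (hv : ‖v‖ = 1) (f : L2) :
    ‖axialField 3 v f‖ ^ 2 = 6 * ‖f‖ ^ 2 := by
  have h : ‖axialField 3 v f‖ ^ 2 = inner ℝ (axialField 3 v f) (axialField 3 v f) :=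
    (real_inner_self_eq_norm_sq (axialField 3 v f)).symm
  have hs := sum_sq_eq_one hv
  rw [h, inner_eq_sum_matComp]
  simp only [matComp_axialField, real_inner_smul_left, real_inner_smul_right,
    Fin.sum_univ_three] at hs ⊢
  simp only [real_inner_self_eq_norm_sq, Fin.isValue, reduceIte, Fin.reduceEq]
  -- With s = |v|², |I₃ - 3 v ⊗ v|² - 6 = 9s² - 6s - 3 = (9s + 3)(s - 1).
  linear_combination (9 * (v 0 * v 0 + v 1 * v 1 + v 2 * v 2) + 3) * ‖f‖ ^ 2 * hs

lemma Pst_eq_self {S : L2sym} (hS : S ∈ strain) : Pst S = S := by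
  have h := (Submodule.starProjection_eq_self_iff (𝕜 := ℝ) (E := L2sym) (K := strain)).mpr hS
  unfold Pst
  exact h

/-- A strain is its own projection, but projecting leaves at most 9/2 ‖f‖² of the squared norm 6
‖f‖². -/
lemma axialField_three_notMem_strain {v : E3} (hv : ‖v‖ = 1) {f : L2} (hf : f ≠ 0) :
    axialField 3 v f ∉ strain := fun h => by
  have h1 := norm_sq_Pst_axialField_le hv 3 f
  rw [Pst_eq_self h, norm_sq_axialField_three hv] at h1
  have : 0 < ‖f‖ ^ 2 := pow_pos (norm_pos_iff.mpr hf) 2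
  linarith

/-- The field has trace 2f, while strains are trace free. -/
lemma axialField_one_notMem_strain {v : E3} (hv : ‖v‖ = 1) {f : L2} (hf : f ≠ 0) :
    axialField 1 v f ∉ strain := fun h => by
  have h1 := sum_matComp_diag_of_mem_strain h
  simp only [matComp_axialField, ← Finset.sum_smul, Finset.sum_sub_distrib, ← Finset.mul_sum,
    sum_sq_eq_one hv, if_true, Finset.sum_const, Finset.card_univ, Fintype.card_fin] at h1
  norm_num [hf] at h1

end StrainSpace

end

open StrainSpace
theorem mainTheorem6 (v : E3) (hv : ‖v‖ = 1) :
    -- no nontrivial purely axial compression along `v` is a strain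
    (∀ lam : L2, 0 ≤ lam → lam ≠ 0 →
      axialField 3 v lam ∉ strain ∧ axialField 1 v lam ∉ strain) ∧
    -- the supremum of the squared projection norm is exactly `3/4`
    IsLUB {r : ℝ | ∃ lam : L2, 0 ≤ lam ∧ ‖lam‖ = 1 ∧ r = ‖Pst (compression v lam)‖ ^ 2} (3 / 4) ∧
    -- the inequality for a single diagonal component, and its sharpness
    (∀ S ∈ strain, ‖doubleDot v S‖ ^ 2 ≤ 1 / 2 * ‖S‖ ^ 2) ∧
    IsLUB {r : ℝ | ∃ S ∈ strain, ‖S‖ = 1 ∧ r = ‖doubleDot v S‖ ^ 2} (1 / 2) ∧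
    -- near-maximizers: Fourier support near the cone
    (∀ ε : ℝ, 0 < ε → ε < 1 → ∀ lam : L2, ‖lam‖ = 1 →
      (∀ᵐ ξ : E3, ξ ∉ coneRegion v ε → fourierReal lam ξ = 0) →
      3 / 4 * (1 - ε) ^ 2 < ‖Pst (compression v lam)‖ ^ 2) ∧
    -- positive Gaussian near-maximizers
    (∀ b : OrthonormalBasis (Fin 3) ℝ E3, inner ℝ v (b 2) ^ 2 = 1 / 2 →
      ∃ (a : ℕ → ℝ) (lam : ℕ → L2),
        (∀ n, 1 ≤ n → 0 < a n ∧ ‖lam n‖ = 1 ∧ (∀ᵐ x : E3, 0 < lam n x) ∧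
          ∀ᵐ ξ : E3, fourierReal (lam n) ξ = ((a n * gaussianProfile b n ξ : ℝ) : ℂ)) ∧
        Tendsto (fun n => ‖Pst (compression v (lam n))‖ ^ 2) atTop (𝓝 (3 / 4))) := by
  obtain ⟨b, hb⟩ := exists_orthonormalBasis_inner_sq hv
  obtain ⟨_, lam, hlam, hlim⟩ := exists_gaussian_sequence hv b hb
  refine ⟨fun f _ hf => ⟨axialField_three_notMem_strain hv hf, axialField_one_notMem_strain hv hf⟩,
    ⟨?_, fun B hB => ?_⟩, fun S hS => norm_sq_doubleDot_le hv hS, ⟨?_, fun B hB => ?_⟩, ?_,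
    fun b hb => exists_gaussian_sequence hv b hb⟩
  · rintro r ⟨f, -, hf, rfl⟩
    rw [norm_sq_Pst_compression hv, hf]
    nlinarith [sq_nonneg ‖dirRiesz v (dirRiesz v f) + (1 / 2 : ℝ) • f‖]
  -- The positive Gaussians are admissible, so every upper bound dominates their limit 3/4.
  · refine le_of_tendsto hlim ?_
    filter_upwards [eventually_ge_atTop 1] with n hn
    obtain ⟨-, h2, h3, -⟩ := hlam n hn
    exact hB ⟨lam n, (Lp.coeFn_nonneg _).mp (h3.mono fun x hx => hx.le), h2, rfl⟩
  · rintro r ⟨S, hS, hS1, rfl⟩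
    simpa [hS1] using norm_sq_doubleDot_le hv hS
  · have hlim' : Tendsto (fun n => ‖Pst (axialField 1 v (lam n))‖ ^ 2) atTop (𝓝 (1 / 2)) := by
      -- The two squared projection norms have the same form with prefactors 2 (for c = 1) and 3,
      -- hence the ratio 2/3.
      have h := hlim.const_mul (2 / 3)
      norm_num only at h
      refine h.congr fun n => ?_
      rw [norm_sq_Pst_compression hv, norm_sq_Pst_axialField hv]
      ring
    refine le_of_tendsto hlim' ?_
    filter_upwards [eventually_ge_atTop 1, hlim'.eventually_const_lt (by norm_num : (0 : ℝ) < 1 / 2)]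
      with n hn hpos
    obtain ⟨S, hS, hS1, hle⟩ := exists_strain_doubleDot_ge (hlam n hn).2.1
      (lt_of_le_of_ne ENNReal.toReal_nonneg fun h => by rw [← h] at hpos; norm_num at hpos)
    exact hle.trans (hB ⟨S, hS, hS1, rfl⟩)
  · intro ε hε hε1 f hf hcone
    have h := norm_dirRiesz_sq_le_of_cone hcone
    rw [hf, mul_one] at h
    rw [norm_sq_Pst_compression hv, hf]
    have h2 := pow_le_pow_left₀ (norm_nonneg _) h 2
    -- The value is at least 3/4 (1 - ε²), which exceeds 3/4 (1 - ε)² by 3/2 ε (1 - ε).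
    nlinarith [mul_pos hε (sub_pos.mpr hε1)]
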